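/- Call a group $G$ \emph{amenable} if there is a finitely additive probability measure $m$, defined on all subsets of $G$, that is left-invariant: $m(gS)=m(S)$ for all $g\in G$ and $S\subseteq G$. The class of \emph{elementary amenable} groups is the smallest class of countable groups that contains all finite groups and all countable abelian groups and is closed under isomorphism, group extensions, countable increasing unions, subgroups, and quotients. Then there exists a finitely generated amenable group that is not elementary amenable. -/

import Mathlib

open scoped Pointwise ENNReal

universe u

/-- A (discrete) group is amenable if it carries a finitely additive, left-invariant probability
measure defined on all of its subsets. -/
def IsAmenableGroup (G : Type u) [Group G] : Prop :=
  ∃ m : Set G → ℝ≥0∞, m Set.univ = 1 ∧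
    (∀ s t : Set G, Disjoint s t → m (s ∪ t) = m s + m t) ∧
    ∀ (g : G) (s : Set G), m (g • s) = m s

/-- The class of elementary amenable groups: the smallest class of countable groups that contains
the finite groups and the countable abelian groups and is closed under group extensions,
increasing unions of sequences, subgroups and quotients. Subgroups and quotients are taken up to
isomorphism (injective, respectively surjective homomorphisms), so the class is closed under
isomorphism. Countability is required of the abelian groups and is inherited by all others. -/
inductive IsElementaryAmenable : (G : Type u) → [Group G] → Prop
  | of_finite (G : Type u) [Group G] (hG : Finite G) : IsElementaryAmenable G
  | of_abelian (G : Type u) [Group G] (hG : Countable G) (hcomm : ∀ a b : G, a * b = b * a) :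
      IsElementaryAmenable G
  | extension (G : Type u) [Group G] (N : Subgroup G) [N.Normal]
      (hN : IsElementaryAmenable N) (hQ : IsElementaryAmenable (G ⧸ N)) :
      IsElementaryAmenable G
  | increasing_union (G : Type u) [Group G] (H : ℕ → Subgroup G) (hmono : Monotone H)
      (hunion : ⋃ n, (H n : Set G) = Set.univ) (hH : ∀ n, IsElementaryAmenable (H n)) :
      IsElementaryAmenable G
  | subgroup (G H : Type u) [Group G] [Group H] (f : H →* G) (hf : Function.Injective f)
      (hG : IsElementaryAmenable G) : IsElementaryAmenable H
  | quotient (G Q : Type u) [Group G] [Group Q] (f : G →* Q) (hf : Function.Surjective f)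
      (hG : IsElementaryAmenable G) : IsElementaryAmenable Q

/-! The witness is Grigorchuk's group, generated by tree automorphisms `a` and `b = (a, c)`, `c =
(a, d)`, `d = (1, b)`: it is finitely generated, infinite, torsion and of subexponential growth.
Elementary amenability fails because finitely generated torsion elementary amenable groups are
finite. The induction works with all sections (quotients of subgroups), which makes closure under
subgroups and quotients immediate. Everything else rests on one contraction (`Cyc.split`): with
suitable letter weights, the two sections of an element have total weight at most 5/6 of its own, up
to a constant. Induction on weight then gives torsion (`Word.isOfFinOrder`); counting pairs of
sections gives a convolution inequality for ball sizes, hence subexponential growth, Følner sets and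
amenability. -/

/-! ### Torsion sections of elementary amenable groups -/

/-- Every finitely generated torsion quotient of a subgroup of `G` is finite. -/
def HasFiniteTorsionSections (G : Type u) [Group G] : Prop :=
  ∀ (S : Subgroup G) (K : Type u) [Group K] (f : S →* K), Function.Surjective f →
    Group.FG K → (∀ x : K, IsOfFinOrder x) → Finite K

namespace HasFiniteTorsionSections

theorem of_comm {G : Type u} [Group G] (hcomm : ∀ a b : G, a * b = b * a) :
    HasFiniteTorsionSections G := by
  intro S K _ f hf hK htor
  let _ : CommGroup K :=
    { mul_comm := fun x y => by
        obtain ⟨a, rfl⟩ := hf x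
        obtain ⟨b, rfl⟩ := hf y
        rw [← map_mul, ← map_mul]
        exact congrArg f (Subtype.ext (hcomm _ _)) }
  exact CommGroup.finite_of_fg_isMulTorsion K htor

theorem of_injective {G H : Type u} [Group G] [Group H] (f : H →* G)
    (hf : Function.Injective f) (hG : HasFiniteTorsionSections G) :
    HasFiniteTorsionSections H := by
  intro S K _ φ hφ hK htor
  let e := S.equivMapOfInjective f hf
  exact hG (S.map f) K (φ.comp e.symm.toMonoidHom) (hφ.comp e.symm.surjective) hK htor

theorem of_surjective {G Q : Type u} [Group G] [Group Q] (f : G →* Q)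
    (hf : Function.Surjective f) (hG : HasFiniteTorsionSections G) :
    HasFiniteTorsionSections Q := by
  intro S K _ φ hφ hK htor
  exact hG (S.comap f) K (φ.comp (f.subgroupComap S))
    (hφ.comp (f.subgroupComap_surjective_of_surjective S hf)) hK htor

/-- The image in `K` of the part of `S` lying in `N` is a section of `N`. -/
theorem finite_map_subgroupOf {G : Type u} [Group G] {N S : Subgroup G}
    (hN : HasFiniteTorsionSections N) {K : Type u} [Group K] (f : S →* K)
    (hfg : Group.FG ((N.subgroupOf S).map f)) (htor : ∀ x : K, IsOfFinOrder x) :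
    Finite ((N.subgroupOf S).map f) := by
  let ι : S.subgroupOf N →* N.subgroupOf S :=
    { toFun := fun x => ⟨⟨x.1.1, x.2⟩, x.1.2⟩
      map_one' := rfl
      map_mul' := fun _ _ => rfl }
  have hι : Function.Surjective ι := fun y => ⟨⟨⟨y.1.1, y.2⟩, y.1.2⟩, rfl⟩
  exact hN (S.subgroupOf N) _ ((f.subgroupMap _).comp ι)
    ((f.subgroupMap_surjective _).comp hι) hfg
    fun x => Submonoid.isOfFinOrder_coe.1 (htor x)

/-- The image `K₁` of `S ∩ N` is normal in `K`, and `K ⧸ K₁` is a section of `G ⧸ N`, hence finite.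
So `K₁` has finite index and is itself finitely generated; being a torsion section of `N`, it is
finite. -/
theorem of_extension {G : Type u} [Group G] (N : Subgroup G) [N.Normal]
    (hN : HasFiniteTorsionSections N) (hQ : HasFiniteTorsionSections (G ⧸ N)) :
    HasFiniteTorsionSections G := by
  intro S K _ f hf hK htor
  let K₁ : Subgroup K := (N.subgroupOf S).map f
  have hnorm : K₁.Normal := Subgroup.Normal.map inferInstance f hf
  let π := (QuotientGroup.mk' N).subgroupMap S
  have hπ : Function.Surjective π := (QuotientGroup.mk' N).subgroupMap_surjective S
  let φ : S →* K ⧸ K₁ := (QuotientGroup.mk' K₁).comp f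
  have hφ : Function.Surjective φ := (QuotientGroup.mk'_surjective K₁).comp hf
  have hker : π.ker ≤ φ.ker := by
    intro x hx
    have hxN : (x : G) ∈ N := by
      have := congrArg Subtype.val (MonoidHom.mem_ker.1 hx)
      exact (QuotientGroup.eq_one_iff _).1 this
    exact (QuotientGroup.eq_one_iff _).2 ⟨x, hxN, rfl⟩
  let ψ := π.liftOfSurjective hπ ⟨φ, hker⟩
  have hψ : Function.Surjective ψ := by
    intro y
    obtain ⟨x, rfl⟩ := hφ y
    exact ⟨π x, MonoidHom.liftOfRightInverse_comp_apply π _ _ ⟨φ, hker⟩ x⟩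
  have hfin : Finite (K ⧸ K₁) := hQ _ _ ψ hψ
    (Group.fg_of_surjective (QuotientGroup.mk'_surjective K₁)) fun y => by
      obtain ⟨x, rfl⟩ := QuotientGroup.mk'_surjective K₁ y
      exact (QuotientGroup.mk' K₁).isOfFinOrder (htor x)
  have hidx : K₁.FiniteIndex := Subgroup.finiteIndex_of_finite_quotient
  have : Finite K₁ := finite_map_subgroupOf hN f (Subgroup.fg_of_index_ne_zero K₁) htor
  exact Finite.of_subgroup_quotient K₁

theorem of_increasing_union {G : Type u} [Group G] (H : ℕ → Subgroup G) (hmono : Monotone H)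
    (hunion : ⋃ n, (H n : Set G) = Set.univ) (hH : ∀ n, HasFiniteTorsionSections (H n)) :
    HasFiniteTorsionSections G := by
  intro S K _ f hf hK htor
  obtain ⟨T, hT⟩ := hK.out
  have hmem : ∀ x : K, ∃ n, x ∈ ((H n).subgroupOf S).map f := by
    intro x
    obtain ⟨s, rfl⟩ := hf x
    obtain ⟨n, hn⟩ := Set.mem_iUnion.1 (hunion ▸ Set.mem_univ (s : G))
    exact ⟨n, s, hn, rfl⟩
  choose n hn using hmem
  -- Finitely many generators of `K` all come from one stage of the union.
  have htop : ((H (T.sup n)).subgroupOf S).map f = ⊤ := by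
    rw [eq_top_iff, ← hT, Subgroup.closure_le]
    intro x hx
    exact Subgroup.map_mono (Subgroup.comap_mono (hmono (Finset.le_sup hx))) (hn x)
  have e : ((H (T.sup n)).subgroupOf S).map f ≃* K :=
    (MulEquiv.subgroupCongr htop).trans Subgroup.topEquiv
  have := finite_map_subgroupOf (hH (T.sup n)) f
    (Group.fg_of_surjective (f := e.symm.toMonoidHom) e.symm.surjective) htor
  exact Finite.of_equiv _ e.toEquiv

end HasFiniteTorsionSections

theorem IsElementaryAmenable.hasFiniteTorsionSections {G : Type u} [Group G]
    (hG : IsElementaryAmenable G) : HasFiniteTorsionSections G := by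
  induction hG with
  | of_finite G hG => exact fun S K _ f hf _ _ => Finite.of_surjective f hf
  | of_abelian G _ hcomm => exact .of_comm hcomm
  | extension G N _ _ hN hQ => exact .of_extension N hN hQ
  | increasing_union G H hmono hunion _ hH => exact .of_increasing_union H hmono hunion hH
  | subgroup G H f hf _ hG => exact .of_injective f hf hG
  | quotient G Q f hf _ hG => exact .of_surjective f hf hG

theorem IsElementaryAmenable.finite_of_fg_torsion {G : Type u} [Group G]
    (hG : IsElementaryAmenable G) (hfg : Group.FG G) (htor : ∀ x : G, IsOfFinOrder x) :
    Finite G :=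
  hG.hasFiniteTorsionSections ⊤ G (Subgroup.topEquiv (G := G)).toMonoidHom Subgroup.topEquiv.surjective
    hfg htor

/-! ### Subexponential growth and amenability -/

-- Otherwise `γ` gains a factor `1 + ε` every `r` steps, so it grows exponentially.
open Filter Topology in
theorem exists_growth_step {γ : ℕ → ℕ} (h1 : ∀ n, 1 ≤ γ n)
    (hsub : ∀ s : ℝ, 0 < s → ∃ C : ℝ, ∀ n, (γ n : ℝ) ≤ C * Real.exp (s * n))
    (r : ℕ) {ε : ℝ} (hε : 0 < ε) : ∃ n, (γ (n + r) : ℝ) ≤ (1 + ε) * γ n := by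
  by_contra! hcon
  have hlow : ∀ k : ℕ, (1 + ε) ^ k ≤ (γ (k * r) : ℝ) := by
    intro k
    induction k with
    | zero => simpa using h1 0
    | succ k ih =>
      have := hcon (k * r)
      rw [← Nat.succ_mul] at this
      rw [pow_succ']
      refine le_trans ?_ this.le
      gcongr
  have hlog : 0 < Real.log (1 + ε) := Real.log_pos (by linarith)
  -- About half the rate forced by `hlow`; `r + 1` keeps the denominator nonzero when `r = 0`.
  obtain ⟨C, hC⟩ := hsub (Real.log (1 + ε) / (2 * (r + 1))) (by positivity)
  have hb : ∀ k : ℕ, Real.exp (Real.log (1 + ε) / 2 * k) ≤ C := by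
    intro k
    have h2 := (hlow k).trans (hC (k * r))
    have h3 : (1 + ε) ^ k = Real.exp (Real.log (1 + ε) * k) := by
      rw [mul_comm, Real.exp_nat_mul, Real.exp_log (by linarith)]
    have hCpos : 0 < C := by
      have : 0 < C * Real.exp (Real.log (1 + ε) / (2 * (r + 1)) * (k * r : ℕ)) :=
        lt_of_lt_of_le (by positivity) h2
      exact pos_of_mul_pos_left this (Real.exp_pos _).le
    have h4 : Real.log (1 + ε) / (2 * (r + 1)) * (k * r : ℕ) ≤ Real.log (1 + ε) / 2 * k := by
      rw [div_mul_eq_mul_div, div_le_iff₀ (by positivity)]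
      push_cast
      have : 0 ≤ Real.log (1 + ε) * k := by positivity
      nlinarith
    have h5 : Real.exp (Real.log (1 + ε) * k) ≤ C * Real.exp (Real.log (1 + ε) / 2 * k) := by
      rw [← h3]
      refine h2.trans ?_
      gcongr
    have h6 : Real.log (1 + ε) * k = Real.log (1 + ε) / 2 * k + Real.log (1 + ε) / 2 * k := by ring
    rw [h6, Real.exp_add] at h5
    exact le_of_mul_le_mul_right h5 (Real.exp_pos _)
  have ht : Tendsto (fun k : ℕ => Real.exp (Real.log (1 + ε) / 2 * k)) atTop atTop :=
    Real.tendsto_exp_atTop.comp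
      ((tendsto_natCast_atTop_atTop).const_mul_atTop (by positivity))
  obtain ⟨k, hk⟩ := (ht.eventually_gt_atTop C).exists
  exact absurd (hb k) (not_le.mpr hk)

open Filter Topology MeasureTheory in
/-- A group exhausted by finite balls of subexponential growth is amenable. -/
theorem isAmenableGroup_of_subexponential {G : Type*} [Group G] (B : ℕ → Set G)
    (hfin : ∀ n, (B n).Finite) (hone : ∀ n, (1 : G) ∈ B n)
    (hmul : ∀ m n g h, g ∈ B m → h ∈ B n → g * h ∈ B (n + m))
    (hex : ∀ g, ∃ n, g ∈ B n)
    (hsub : ∀ s : ℝ, 0 < s → ∃ C : ℝ, ∀ n, ((B n).ncard : ℝ) ≤ C * Real.exp (s * n)) :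
    IsAmenableGroup G := by
  have hpos : ∀ n, 1 ≤ (B n).ncard := fun n =>
    (Set.ncard_pos (hfin n)).2 ⟨1, hone n⟩
  have hmono : ∀ m k, B m ⊆ B (m + k) := fun m k g hg => by
    simpa using hmul k m 1 g (hone k) hg
  have hstep := fun k : ℕ => exists_growth_step hpos hsub k (ε := 1 / ((k : ℝ) + 1)) (by positivity)
  choose N hN using hstep
  let _ : MeasurableSpace G := ⊤
  have hinv : SMulInvariantMeasure G G (Measure.count : Measure G) := ⟨fun c s _ => by
    rw [Set.preimage_smul, Measure.count_apply MeasurableSpace.measurableSet_top,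
      Measure.count_apply MeasurableSpace.measurableSet_top, Set.encard_smul_set]⟩
  have hF : IsFoelner G (Measure.count : Measure G) atTop (fun k => B (N k)) := by
    have hcard : ∀ s : Set G, s.Finite → (Measure.count s : ℝ≥0∞) = (s.ncard : ℝ≥0∞) := by
      intro s hs
      rw [Measure.count_apply MeasurableSpace.measurableSet_top, ← hs.cast_ncard_eq]
      rfl
    refine ⟨.of_forall fun _ => trivial, .of_forall fun k => ?_, .of_forall fun k => ?_,
      fun g => ?_⟩
    · rw [hcard _ (hfin _)]
      have := hpos (N k)
      simp only [ne_eq, Nat.cast_eq_zero]; omega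
    · rw [hcard _ (hfin _)]; simp
    · obtain ⟨r, hr⟩ := hex g
      have hlim : Tendsto (fun k : ℕ => ENNReal.ofReal (2 * (1 / ((k : ℝ) + 1)))) atTop (𝓝 0) := by
        rw [← ENNReal.ofReal_zero]
        refine ENNReal.tendsto_ofReal ?_
        simpa using (tendsto_one_div_add_atTop_nhds_zero_nat (𝕜 := ℝ)).const_mul 2
      refine tendsto_of_tendsto_of_tendsto_of_le_of_le' tendsto_const_nhds hlim
        (.of_forall fun _ => zero_le) ?_
      -- Once `k ≥ r`, both `F` and `g • F` lie in the slightly larger ball `E`, so their symmetric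
      -- difference has at most `2 (|E| - |F|)` elements.
      filter_upwards [eventually_ge_atTop r] with k hk
      set F := B (N k)
      set E := B (N k + k)
      have hEf : E.Finite := hfin _
      have hFE : F ⊆ E := hmono _ _
      have hgE : g • F ⊆ E := by
        rintro _ ⟨h, hh, rfl⟩
        refine hmul k (N k) g h ?_ hh
        obtain ⟨j, rfl⟩ := Nat.exists_eq_add_of_le hk
        exact hmono _ _ hr
      have hFf : F.Finite := hfin _
      have hgF : (g • F).Finite := hFf.smul_set
      have e1 : (E \ F).ncard = E.ncard - F.ncard := Set.ncard_sdiff hFE hFf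
      have e2 : (E \ (g • F)).ncard = E.ncard - F.ncard := by
        rw [Set.ncard_sdiff hgE hgF, Set.ncard_smul_set]
      have hsd : symmDiff (g • F) F ⊆ (E \ F) ∪ (E \ (g • F)) := by
        rintro x (⟨h1, h2⟩ | ⟨h1, h2⟩)
        · exact Or.inl ⟨hgE h1, h2⟩
        · exact Or.inr ⟨hFE h1, h2⟩
      have hle : (symmDiff (g • F) F).ncard ≤ 2 * (E.ncard - F.ncard) := by
        refine (Set.ncard_le_ncard hsd (hEf.sdiff.union hEf.sdiff)).trans ?_
        refine (Set.ncard_union_le _ _).trans ?_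
        omega
      have hEFle : F.ncard ≤ E.ncard := Set.ncard_le_ncard hFE hEf
      have hreal : ((symmDiff (g • F) F).ncard : ℝ) ≤ 2 * (1 / ((k : ℝ) + 1)) * F.ncard := by
        have h1 : ((symmDiff (g • F) F).ncard : ℝ) ≤ 2 * ((E.ncard : ℝ) - F.ncard) := by
          rw [← Nat.cast_sub hEFle]; exact_mod_cast hle
        have h2 := hN k
        change (E.ncard : ℝ) ≤ _ * (F.ncard : ℝ) at h2
        linarith
      have hFpos : F.ncard ≠ 0 := by have := hpos (N k); simp only [F]; omega
      rw [hcard _ ((hEf.sdiff.union hEf.sdiff).subset hsd), hcard _ hFf,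
        ENNReal.div_le_iff (by exact_mod_cast hFpos) (by simp),
        ← ENNReal.ofReal_natCast, ← ENNReal.ofReal_natCast, ← ENNReal.ofReal_mul (by positivity)]
      exact ENNReal.ofReal_le_ofReal hreal
  obtain ⟨m, hm1, hm2, hm3⟩ := hF.amenable
  exact ⟨m, hm1, fun s t h => hm2 s t trivial h, hm3⟩

/-- A ball count satisfying a contracting convolution inequality grows subexponentially. -/
theorem subexponential_of_contracting {γ : ℕ → ℕ} (h5 : ∀ n, γ n ≤ 5 ^ n)
    (hrec : ∀ n, ∃ m, 6 * m ≤ 5 * (n + 3) ∧ γ n ≤ 2 * ∑ i ∈ Finset.range (m + 1), γ i * γ (m - i))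
    (s : ℝ) (hs : 0 < s) : ∃ C : ℝ, ∀ n, (γ n : ℝ) ≤ C * Real.exp (s * n) := by
  let S : ℝ → Prop := fun s => ∃ C : ℝ, ∀ n, (γ n : ℝ) ≤ C * Real.exp (s * n)
  have hmono : ∀ s t, s ≤ t → S s → S t := by
    rintro s t hst ⟨C, hC⟩
    refine ⟨|C|, fun n => (hC n).trans ?_⟩
    gcongr
    exact le_abs_self C
  have hstart : S (Real.log 5) := by
    refine ⟨1, fun n => ?_⟩
    rw [one_mul, mul_comm, Real.exp_nat_mul, Real.exp_log (by norm_num)]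
    exact_mod_cast h5 n
  -- Here `11/12 = 5/6 + 1/12`: the convolution runs up to `m ≈ 5n/6`, and its `m + 1` terms are
  -- absorbed by `exp (s * n / 12)`. Iterating drives the rate to zero.
  have hcontr : ∀ s, 0 < s → S s → S (11 / 12 * s) := by
    rintro s hs ⟨C, hC⟩
    have hC0 : 0 ≤ C := by
      have := hC 0
      simp only [Nat.cast_zero, mul_zero, Real.exp_zero, mul_one] at this
      exact le_trans (Nat.cast_nonneg _) this
    refine ⟨2 * C ^ 2 * (12 / s) * Real.exp (s * (5 / 2) + s / 3), fun n => ?_⟩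
    obtain ⟨m, hm, hg⟩ := hrec n
    have hm' : (m : ℝ) ≤ 5 / 6 * n + 5 / 2 := by
      have : (6 * m : ℝ) ≤ 5 * (n + 3) := by exact_mod_cast hm
      linarith
    have h1 : (γ n : ℝ) ≤ 2 * ((m + 1) * (C ^ 2 * Real.exp (s * m))) := by
      calc (γ n : ℝ) ≤ ((2 * ∑ i ∈ Finset.range (m + 1), γ i * γ (m - i) : ℕ) : ℝ) := by
            exact_mod_cast hg
        _ = 2 * ∑ i ∈ Finset.range (m + 1), (γ i : ℝ) * γ (m - i) := by push_cast; rfl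
        _ ≤ 2 * ∑ i ∈ Finset.range (m + 1), C ^ 2 * Real.exp (s * m) := by
            refine mul_le_mul_of_nonneg_left (Finset.sum_le_sum fun i hi => ?_) zero_le_two
            have him : i ≤ m := by simpa [Nat.lt_succ_iff] using hi
            calc (γ i : ℝ) * γ (m - i)
                ≤ (C * Real.exp (s * i)) * (C * Real.exp (s * (m - i : ℕ))) := by
                  gcongr
                  · exact hC i
                  · exact hC _
              _ = C ^ 2 * Real.exp (s * m) := by
                  rw [Nat.cast_sub him,
                    show s * (m : ℝ) = s * i + s * (m - i) by ring, Real.exp_add]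
                  ring
        _ = _ := by simp
    have h2 : ((m : ℝ) + 1) ≤ 12 / s * Real.exp (s / 12 * (n + 4)) := by
      have h3 := Real.add_one_le_exp (s / 12 * ((n : ℝ) + 4))
      have h4 : (m : ℝ) + 1 ≤ n + 4 := by
        have : (0 : ℝ) ≤ n := Nat.cast_nonneg n
        linarith
      refine h4.trans ?_
      rw [div_mul_eq_mul_div, le_div_iff₀ hs]
      linarith
    have h5 : Real.exp (s * m) ≤ Real.exp (s * (5 / 6 * n + 5 / 2)) := by gcongr
    calc (γ n : ℝ) ≤ 2 * ((m + 1) * (C ^ 2 * Real.exp (s * m))) := h1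
      _ ≤ 2 * ((12 / s * Real.exp (s / 12 * (n + 4))) *
          (C ^ 2 * Real.exp (s * (5 / 6 * n + 5 / 2)))) := by gcongr
      _ = 2 * C ^ 2 * (12 / s) *
          (Real.exp (s / 12 * (n + 4)) * Real.exp (s * (5 / 6 * n + 5 / 2))) := by ring
      _ = 2 * C ^ 2 * (12 / s) *
          (Real.exp (s * (5 / 2) + s / 3) * Real.exp (11 / 12 * s * n)) := by
          rw [← Real.exp_add, ← Real.exp_add]; ring_nf
      _ = _ := by ring
  have hiter : ∀ k : ℕ, S ((11 / 12) ^ k * Real.log 5) := by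
    intro k
    induction k with
    | zero => simpa using hstart
    | succ k ih =>
      rw [pow_succ', mul_assoc]
      exact hcontr _ (mul_pos (by positivity) (Real.log_pos (by norm_num))) ih
  have hl : 0 < Real.log 5 := Real.log_pos (by norm_num)
  obtain ⟨k, hk⟩ := exists_pow_lt_of_lt_one (div_pos hs hl) (show (11 / 12 : ℝ) < 1 by norm_num)
  exact hmono _ _ ((lt_div_iff₀ hl).1 hk).le (hiter k)

/-! ### Tree automorphisms and the generators -/

namespace Grigorchuk

/-- Permutations of the infinite binary rooted tree, seen on its vertices. -/
abbrev P := Equiv.Perm (List Bool)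

/-- Exchange of the two subtrees of the root. -/
def flip : List Bool → List Bool
  | [] => []
  | t :: l => (!t) :: l

theorem flip_flip : ∀ l, flip (flip l) = l
  | [] => rfl
  | t :: l => by simp [flip]

/-- The generator exchanging the two subtrees of the root. -/
def a : P := Function.Involutive.toPerm flip flip_flip

theorem a_mul_a : a * a = 1 := Equiv.ext flip_flip

/-- The action of the letters of the Klein group: `(true, false)`, `(true, true)`, `(false, true)`
act as the generators `b`, `c`, `d`. -/
def klein : Bool → Bool → List Bool → List Bool
  | _, _, [] => []
  | u, _, false :: l => false :: (bif u then flip l else l)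
  | u, v, true :: l => true :: klein (xor u v) u l

theorem klein_klein (u v u' v' : Bool) (l : List Bool) :
    klein u v (klein u' v' l) = klein (xor u u') (xor v v') l := by
  induction l generalizing u v u' v' with
  | nil => rfl
  | cons t l ih =>
    cases t
    · cases u <;> cases u' <;> simp [klein, flip_flip]
    · simp only [klein, ih]
      congr 2
      cases u <;> cases v <;> cases u' <;> cases v' <;> rfl

theorem klein_false_false (l : List Bool) : klein false false l = l := by
  induction l with
  | nil => rfl
  | cons t l ih => cases t <;> simp [klein, ih]

/-- The Klein letters as tree automorphisms. -/
def k (u v : Bool) : P :=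
  Function.Involutive.toPerm (klein u v) fun l => by
    rw [klein_klein, Bool.xor_self, Bool.xor_self, klein_false_false]

theorem k_mul_k (u v u' v' : Bool) : k u v * k u' v' = k (xor u u') (xor v v') :=
  Equiv.ext (klein_klein u v u' v')

theorem k_false_false : k false false = 1 := Equiv.ext klein_false_false

theorem k_mul_self (u v : Bool) : k u v * k u v = 1 := by
  rw [k_mul_k, Bool.xor_self, Bool.xor_self, k_false_false]

/-- The automorphism acting by `p` and `q` on the two subtrees of the root. -/
def pair (p q : P) : P where
  toFun
    | [] => []
    | false :: l => false :: p l
    | true :: l => true :: q l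
  invFun
    | [] => []
    | false :: l => false :: p.symm l
    | true :: l => true :: q.symm l
  left_inv := by rintro (_ | ⟨_ | _, l⟩) <;> simp
  right_inv := by rintro (_ | ⟨_ | _, l⟩) <;> simp

theorem pair_mul_pair (p q p' q' : P) : pair p q * pair p' q' = pair (p * p') (q * q') := by
  ext1 l
  rcases l with _ | ⟨_ | _, l⟩ <;> rfl

theorem pair_one : pair 1 1 = 1 := by
  ext1 l
  rcases l with _ | ⟨_ | _, l⟩ <;> rfl

theorem a_mul_pair (p q : P) : a * pair p q = pair q p * a := by
  ext1 l
  change flip (pair p q l) = pair q p (flip l)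
  rcases l with _ | ⟨_ | _, l⟩ <;> rfl

theorem pair_pow (p q : P) (n : ℕ) : pair p q ^ n = pair (p ^ n) (q ^ n) := by
  induction n with
  | zero => simp [pair_one]
  | succ n ih => rw [pow_succ, ih, pair_mul_pair, ← pow_succ, ← pow_succ]

theorem pair_injective {p q p' q' : P} (h : pair p q = pair p' q') : p = p' ∧ q = q' := by
  constructor
  · ext1 l
    exact (List.cons.inj (DFunLike.congr_fun h (false :: l))).2
  · ext1 l
    exact (List.cons.inj (DFunLike.congr_fun h (true :: l))).2

theorem a_ne_pair (p q : P) : a ≠ pair p q := fun h => by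
  have h' : [true] = false :: p [] := DFunLike.congr_fun h [false]
  simp at h'

theorem k_eq_pair (u v : Bool) : k u v = pair (bif u then a else 1) (k (xor u v) u) := by
  ext1 l
  rcases l with _ | ⟨_ | _, l⟩
  · rfl
  · cases u <;> rfl
  · rfl

/-! ### Weighted words -/

/-- Weights of the Klein letters; the generator `a` has weight `3`. -/
def wt : Bool → Bool → ℕ
  | false, false => 0
  | true, false => 3
  | true, true => 2
  | false, true => 1

theorem wt_xor_le (u v u' v' : Bool) : wt (xor u u') (xor v v') ≤ wt u v + wt u' v' := by
  revert u v u' v'; decide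

/-- `Cyc n g`: `g` is a product of blocks `a * k u v` of total weight `n`. -/
inductive Cyc : ℕ → P → Prop
  | one : Cyc 0 1
  | mul {n : ℕ} {g : P} (h : Cyc n g) (u v : Bool) : Cyc (n + 3 + wt u v) (g * a * k u v)

/-- `Word n g`: `g` is represented by a word of weight at most `n` in the generators. -/
def Word (n : ℕ) (g : P) : Prop :=
  ∃ u v i h, Cyc i h ∧ g = k u v * h ∧ wt u v + i ≤ n

theorem Word.mono {m n : ℕ} {g : P} (h : Word m g) (hmn : m ≤ n) : Word n g := by
  obtain ⟨u, v, i, h, hc, rfl, hle⟩ := h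
  exact ⟨u, v, i, h, hc, rfl, hle.trans hmn⟩

theorem word_k (u v : Bool) : Word (wt u v) (k u v) :=
  ⟨u, v, 0, 1, .one, by simp, by simp⟩

theorem Cyc.word {n : ℕ} {g : P} (h : Cyc n g) : Word n g :=
  ⟨false, false, n, g, h, by simp [k_false_false], by simp [wt]⟩

theorem word_one (n : ℕ) : Word n 1 := Cyc.one.word.mono n.zero_le

theorem Word.mul_k {n : ℕ} {g : P} (h : Word n g) (u v : Bool) :
    Word (n + wt u v) (g * k u v) := by
  obtain ⟨x, y, i, h, hc, rfl, hle⟩ := h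
  cases hc with
  | one =>
    refine ⟨xor x u, xor y v, 0, 1, .one, by simp [k_mul_k], ?_⟩
    have := wt_xor_le x y u v
    omega
  | @mul j h hc z w =>
    refine ⟨x, y, _, _, hc.mul (xor z u) (xor w v), by simp [← k_mul_k, mul_assoc], ?_⟩
    have := wt_xor_le z w u v
    omega

theorem Word.mul_a {n : ℕ} {g : P} (h : Word n g) : Word (n + 3) (g * a) := by
  obtain ⟨x, y, i, h, hc, rfl, hle⟩ := h
  refine ⟨x, y, _, _, hc.mul false false, by simp [k_false_false, mul_assoc], ?_⟩
  simp only [show wt false false = 0 from rfl]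
  omega

theorem Word.mul {m n : ℕ} {g h : P} (hg : Word m g) (hh : Word n h) : Word (m + n) (g * h) := by
  obtain ⟨x, y, i, h, hc, rfl, hle⟩ := hh
  have key : ∀ {i h}, Cyc i h → Word (m + wt x y + i) (g * (k x y * h)) := by
    intro i h hc
    induction hc with
    | one => simpa using hg.mul_k x y
    | mul _ u v ih =>
      have := ih.mul_a.mul_k u v
      simp only [mul_assoc, ← add_assoc] at this ⊢
      exact this
  exact (key hc).mono (by omega)

theorem word_a : Word 3 a := by simpa using (word_one 0).mul_a

theorem k_inv (u v : Bool) : (k u v)⁻¹ = k u v := inv_eq_of_mul_eq_one_left (k_mul_self u v)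

theorem a_inv : a⁻¹ = a := inv_eq_of_mul_eq_one_left a_mul_a

theorem Word.inv {n : ℕ} {g : P} (h : Word n g) : Word n g⁻¹ := by
  obtain ⟨x, y, i, h, hc, rfl, hle⟩ := h
  have key : ∀ {i h}, Cyc i h → Word i h⁻¹ := by
    intro i h hc
    induction hc with
    | one => simpa using word_one 0
    | mul _ u v ih =>
      have := ((word_k u v).mul word_a).mul ih
      simp only [mul_inv_rev, k_inv, a_inv, ← mul_assoc] at this ⊢
      exact this.mono (by omega)
  have := (key hc).mul (word_k x y)
  rw [mul_inv_rev, k_inv]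
  exact this.mono (by omega)

theorem word_bif_a (u : Bool) : Word (bif u then 3 else 0) (bif u then a else 1) := by
  cases u
  · exact word_one 0
  · exact word_a

/-- The weights are chosen for this: blocks `ab`, `ac`, `ad` of weights 6, 5, 4 yield sections of
total weights 5, 4, 3. -/
theorem six_mul_wt_le (u v : Bool) :
    6 * ((bif u then 3 else 0) + wt (xor u v) u) ≤ 5 * (wt u v + 3) := by
  revert u v; decide

/-! ### Contraction under passing to subtrees -/

/-- `Split n g`: `g` acts on the two subtrees by words of weight at most `n` in total, possibly
after exchanging them. -/
def Split (n : ℕ) (g : P) : Prop :=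
  ∃ p q i j, Word i p ∧ Word j q ∧ 6 * (i + j) ≤ n ∧ (g = pair p q ∨ g = pair p q * a)

theorem split_k (u v : Bool) : Split (5 * (wt u v + 3)) (k u v) :=
  ⟨_, _, _, _, word_bif_a u, word_k _ _, six_mul_wt_le u v, .inl (k_eq_pair u v)⟩

theorem Split.mul {m n : ℕ} {g h : P} (hg : Split m g) (hh : Split n h) :
    Split (m + n) (g * h) := by
  obtain ⟨p, q, i, j, hp, hq, hij, hg⟩ := hg
  obtain ⟨p', q', i', j', hp', hq', hij', hh⟩ := hh
  rcases hg with rfl | rfl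
  · refine ⟨_, _, _, _, hp.mul hp', hq.mul hq', by omega, ?_⟩
    rcases hh with rfl | rfl
    · exact .inl (pair_mul_pair ..)
    · exact .inr (by rw [← mul_assoc, pair_mul_pair])
  · refine ⟨_, _, _, _, hp.mul hq', hq.mul hp', by omega, ?_⟩
    rcases hh with rfl | rfl
    · exact .inr (by rw [mul_assoc, a_mul_pair, ← mul_assoc, pair_mul_pair])
    · refine .inl ?_
      rw [mul_assoc, ← mul_assoc a, a_mul_pair, mul_assoc (pair _ _), a_mul_a, mul_one,
        pair_mul_pair]

theorem split_a : Split 0 a :=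
  ⟨1, 1, 0, 0, word_one 0, word_one 0, le_rfl, .inr (by rw [pair_one, one_mul])⟩

theorem Cyc.split {n : ℕ} {g : P} (h : Cyc n g) : Split (5 * n) g := by
  induction h with
  | one => exact ⟨1, 1, 0, 0, word_one 0, word_one 0, le_rfl, .inl pair_one.symm⟩
  | @mul n g _ u v ih =>
    have := (ih.mul split_a).mul (split_k u v)
    rwa [show 5 * n + 0 + 5 * (wt u v + 3) = 5 * (n + 3 + wt u v) by ring] at this

theorem Split.mono {m n : ℕ} {g : P} (h : Split m g) (hmn : m ≤ n) : Split n g := by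
  obtain ⟨p, q, i, j, hp, hq, hij, hg⟩ := h
  exact ⟨p, q, i, j, hp, hq, hij.trans hmn, hg⟩

theorem Word.split {n : ℕ} {g : P} (h : Word n g) : Split (5 * (n + 3)) g := by
  obtain ⟨x, y, i, h, hc, rfl, hle⟩ := h
  exact ((split_k x y).mul hc.split).mono (by omega)

/-! ### Torsion -/

theorem isOfFinOrder_of_mul_self {x : P} (h : IsOfFinOrder (x * x)) : IsOfFinOrder x := by
  rw [← pow_two] at h
  exact (isOfFinOrder_pow.1 h).resolve_right two_ne_zero

theorem isOfFinOrder_pair {p q : P} (hp : IsOfFinOrder p) (hq : IsOfFinOrder q) :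
    IsOfFinOrder (pair p q) := by
  rw [isOfFinOrder_iff_pow_eq_one] at *
  obtain ⟨m, hm, hpm⟩ := hp
  obtain ⟨n, hn, hqn⟩ := hq
  refine ⟨m * n, Nat.mul_pos hm hn, ?_⟩
  rw [pair_pow, pow_mul, hpm, one_pow, mul_comm, pow_mul, hqn, one_pow, pair_one]

theorem isOfFinOrder_mul_comm {p q : P} (h : IsOfFinOrder (p * q)) : IsOfFinOrder (q * p) := by
  have := (MulAut.conj q).toMonoidHom.isOfFinOrder h
  simpa [mul_assoc] using this

theorem Word.isOfFinOrder {n : ℕ} {g : P} (h : Word n g) : IsOfFinOrder g := by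
  induction n using Nat.strong_induction_on generalizing g with
  | _ n ih =>
  -- Without a leading Klein letter the contraction has no additive constant, so section weights
  -- drop strictly. If the subtrees are exchanged, the square is `pair (p * q) (q * p)`, whose
  -- entries are conjugate.
  have cyc : ∀ {i h}, Cyc i h → 0 < i → i ≤ n → IsOfFinOrder h := by
    intro i h hc hi hin
    obtain ⟨p, q, r, s, hp, hq, hrs, rfl | rfl⟩ := hc.split
    · exact isOfFinOrder_pair (ih r (by omega) hp) (ih s (by omega) hq)
    · apply isOfFinOrder_of_mul_self
      rw [mul_assoc, ← mul_assoc a, a_mul_pair, mul_assoc (pair _ _), a_mul_a, mul_one,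
        pair_mul_pair]
      have := ih (r + s) (by omega) (hp.mul hq)
      exact isOfFinOrder_pair this (isOfFinOrder_mul_comm this)
  obtain ⟨x, y, i, h, hc, rfl, hle⟩ := h
  cases hc with
  | one =>
    apply isOfFinOrder_of_mul_self
    simp [k_mul_self, IsOfFinOrder.one]
  | @mul j h hc z w =>
    -- Conjugation moves the leading Klein letter to the end, where it merges with the last block.
    apply isOfFinOrder_mul_comm
    rw [mul_assoc, k_mul_k]
    have := wt_xor_le z w x y
    exact cyc (hc.mul _ _) (by omega) (by omega)

/-! ### The group: finitely generated, torsion, infinite -/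

/-- The letters of the generating set. -/
def gens : Set P := {a, k true false, k true true, k false true}

/-- The first Grigorchuk group. -/
def grigorchuk : Subgroup P := Subgroup.closure gens

theorem a_mem : a ∈ grigorchuk := Subgroup.subset_closure (by simp [gens])

theorem k_mem (u v : Bool) : k u v ∈ grigorchuk := by
  cases u <;> cases v
  · rw [k_false_false]; exact one_mem _
  all_goals exact Subgroup.subset_closure (by simp [gens])

theorem Word.mem {n : ℕ} {g : P} (h : Word n g) : g ∈ grigorchuk := by
  obtain ⟨x, y, i, h, hc, rfl, hle⟩ := h
  refine mul_mem (k_mem _ _) ?_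
  clear hle
  induction hc with
  | one => exact one_mem _
  | mul _ u v ih => exact mul_mem (mul_mem ih a_mem) (k_mem _ _)

theorem exists_word {g : P} (hg : g ∈ grigorchuk) : ∃ n, Word n g := by
  induction hg using Subgroup.closure_induction with
  | mem x hx =>
    rcases hx with rfl | rfl | rfl | rfl
    exacts [⟨_, word_a⟩, ⟨_, word_k _ _⟩, ⟨_, word_k _ _⟩, ⟨_, word_k _ _⟩]
  | one => exact ⟨0, word_one 0⟩
  | mul x y _ _ hx hy => exact ⟨_, hx.choose_spec.mul hy.choose_spec⟩
  | inv x _ hx => exact ⟨_, hx.choose_spec.inv⟩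

theorem fg_grigorchuk : Group.FG grigorchuk := by
  rw [Group.fg_iff_subgroup_fg, Subgroup.fg_iff]
  exact ⟨gens, rfl, by simp [gens]⟩

theorem isOfFinOrder_grigorchuk (g : grigorchuk) : IsOfFinOrder g :=
  Submonoid.isOfFinOrder_coe.1 (exists_word g.2).choose_spec.isOfFinOrder

/-- Every element of the group is the first section of an element fixing the first level. -/
theorem exists_pair_mem {g : P} (hg : g ∈ grigorchuk) : ∃ q, pair g q ∈ grigorchuk := by
  have hk : ∀ u v, ∃ q, pair (k (xor u v) u) q ∈ grigorchuk := fun u v => by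
    refine ⟨bif u then a else 1, ?_⟩
    -- Conjugating by `a` swaps the sections, bringing the Klein section to the first place.
    have := mul_mem (mul_mem a_mem (k_mem u v)) a_mem
    rwa [k_eq_pair, a_mul_pair, mul_assoc, a_mul_a, mul_one] at this
  induction hg using Subgroup.closure_induction with
  | mem x hx =>
    rcases hx with rfl | rfl | rfl | rfl
    · exact ⟨_, k_eq_pair true false ▸ k_mem true false⟩
    · exact hk false true
    · exact hk true false
    · exact hk true true
  | one => exact ⟨1, by rw [pair_one]; exact one_mem _⟩
  | mul x y _ _ hx hy =>
    obtain ⟨q, hq⟩ := hx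
    obtain ⟨r, hr⟩ := hy
    exact ⟨q * r, pair_mul_pair .. ▸ mul_mem hq hr⟩
  | inv x _ hx =>
    obtain ⟨q, hq⟩ := hx
    refine ⟨q⁻¹, ?_⟩
    have : pair x⁻¹ q⁻¹ = (pair x q)⁻¹ :=
      eq_inv_of_mul_eq_one_left (by simp [pair_mul_pair, pair_one])
    exact this ▸ inv_mem hq

/-- A choice of `g ↦ pair g (q g)` is an injective self-map that misses `a`. -/
theorem infinite_grigorchuk : Infinite grigorchuk := by
  rw [← not_finite_iff_infinite]
  intro hfin
  choose q hq using fun g : grigorchuk => exists_pair_mem g.2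
  let f : grigorchuk → grigorchuk := fun g => ⟨pair g (q g), hq g⟩
  have hf : Function.Injective f := fun g h hgh =>
    Subtype.ext (pair_injective (congrArg Subtype.val hgh)).1
  obtain ⟨g, hg⟩ := Finite.surjective_of_injective hf ⟨a, a_mem⟩
  exact a_ne_pair _ _ (congrArg Subtype.val hg).symm

/-! ### Growth and amenability of the group -/

/-- The ball of radius `n` for the weighted word metric. -/
def ball (n : ℕ) : Set P := {g | Word n g}

theorem finite_ball_and_ncard_le (n : ℕ) : (ball n).Finite ∧ (ball n).ncard ≤ 5 ^ n := by
  induction n with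
  | zero =>
    have h0 : ball 0 = {1} := by
      refine Set.eq_singleton_iff_unique_mem.2 ⟨word_one 0, ?_⟩
      rintro _ ⟨x, y, i, h, hc, rfl, hle⟩
      have hxy : wt x y = 0 := by omega
      have hk : k x y = 1 := by
        cases x <;> cases y <;> simp_all [wt, k_false_false]
      cases hc with
      | one => simp [hk]
      | mul => omega
    simp [h0]
  | succ n ih =>
    classical
    let T : Finset P := {1, a, k true false, k true true, k false true}
    have hT : ∀ x y, k x y ∈ T := by
      intro x y
      cases x <;> cases y <;> simp [T, k_false_false]
    have hwt : ∀ x y, (x = false ∧ y = false) ∨ 1 ≤ wt x y := by decide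
    -- Strip the last nontrivial letter; each has weight at least one.
    have hsub : ball (n + 1) ⊆ ball n * (T : Set P) := by
      rintro _ ⟨x, y, i, h, hc, rfl, hle⟩
      cases hc with
      | one =>
        exact ⟨1, word_one n, k x y, hT x y, by simp⟩
      | @mul j h hc u v =>
        rcases hwt u v with ⟨rfl, rfl⟩ | huv
        · exact ⟨k x y * h, ⟨x, y, j, h, hc, rfl, by omega⟩, a, by simp [T],
            by simp [k_false_false, mul_assoc]⟩
        · exact ⟨k x y * h * a, (Word.mul_a ⟨x, y, j, h, hc, rfl, le_rfl⟩).mono (by omega),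
            k u v, hT u v, by simp [mul_assoc]⟩
    have hTc : (T : Set P).ncard ≤ 5 := by
      rw [Set.ncard_coe_finset]
      exact Finset.card_le_five
    refine ⟨(ih.1.mul T.finite_toSet).subset hsub, ?_⟩
    calc (ball (n + 1)).ncard ≤ (ball n * (T : Set P)).ncard :=
          Set.ncard_le_ncard hsub (ih.1.mul T.finite_toSet)
      _ ≤ (ball n).ncard * (T : Set P).ncard := Set.natCard_mul_le
      _ ≤ 5 ^ n * 5 := Nat.mul_le_mul ih.2 hTc
      _ = 5 ^ (n + 1) := (pow_succ ..).symm

theorem ncard_ball_le (n : ℕ) : ∃ m, 6 * m ≤ 5 * (n + 3) ∧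
    (ball n).ncard ≤ 2 * ∑ i ∈ Finset.range (m + 1), (ball i).ncard * (ball (m - i)).ncard := by
  refine ⟨5 * (n + 3) / 6, by omega, ?_⟩
  set m := 5 * (n + 3) / 6 with hm
  let D : Set (P × P) := ⋃ i ∈ Finset.range (m + 1), ball i ×ˢ ball (m - i)
  have hDfin : D.Finite := Set.Finite.biUnion (Finset.finite_toSet _) fun i _ =>
    (finite_ball_and_ncard_le i).1.prod (finite_ball_and_ncard_le _).1
  have hD : D.ncard ≤ ∑ i ∈ Finset.range (m + 1), (ball i).ncard * (ball (m - i)).ncard := by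
    refine (Finset.set_ncard_biUnion_le _ _).trans (Finset.sum_le_sum fun i _ => ?_)
    rw [Set.ncard_prod]
  -- An element is determined by its two sections and whether it exchanges the subtrees, whence the
  -- factor 2.
  have hsub : ball n ⊆ (fun x : P × P => pair x.1 x.2) '' D ∪
      (fun x : P × P => pair x.1 x.2 * a) '' D := by
    intro g hg
    obtain ⟨p, q, i, j, hp, hq, hij, h⟩ := Word.split hg
    have hmem : (p, q) ∈ D := by
      refine Set.mem_biUnion (x := i) ?_ ⟨hp, hq.mono ?_⟩
      · simp only [Finset.coe_range, Set.mem_Iio]; omega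
      · omega
    rcases h with rfl | rfl
    · exact .inl ⟨_, hmem, rfl⟩
    · exact .inr ⟨_, hmem, rfl⟩
  calc (ball n).ncard ≤ _ := Set.ncard_le_ncard hsub ((hDfin.image _).union (hDfin.image _))
    _ ≤ _ := Set.ncard_union_le _ _
    _ ≤ D.ncard + D.ncard := add_le_add (Set.ncard_image_le hDfin) (Set.ncard_image_le hDfin)
    _ ≤ _ := by omega

theorem isAmenableGroup_grigorchuk : IsAmenableGroup grigorchuk := by
  have hcard : ∀ n, (((↑) : grigorchuk → P) ⁻¹' ball n).ncard = (ball n).ncard := fun n =>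
    Set.ncard_preimage_of_injective_subset_range Subtype.val_injective
      fun g hg => ⟨⟨g, Word.mem hg⟩, rfl⟩
  refine isAmenableGroup_of_subexponential (fun n => ((↑) : grigorchuk → P) ⁻¹' ball n)
    (fun n => (finite_ball_and_ncard_le n).1.preimage Subtype.val_injective.injOn)
    word_one (fun m n g h hg hh => ?_) (fun g => exists_word g.2) ?_
  · exact (Word.mul hg hh).mono (add_comm m n).le
  · simp only [hcard]
    exact subexponential_of_contracting (fun n => (finite_ball_and_ncard_le n).2) ncard_ball_le

end Grigorchuk

theorem mainTheorem4 :
    ∃ (G : Type) (_ : Group G),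
      Group.FG G ∧ IsAmenableGroup G ∧ ¬ IsElementaryAmenable G :=
  ⟨Grigorchuk.grigorchuk, inferInstance, Grigorchuk.fg_grigorchuk,
    Grigorchuk.isAmenableGroup_grigorchuk, fun h =>
      not_finite_iff_infinite.2 Grigorchuk.infinite_grigorchuk
        (h.finite_of_fg_torsion Grigorchuk.fg_grigorchuk Grigorchuk.isOfFinOrder_grigorchuk)⟩
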